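/- Throughout, a graph is an undirected multigraph: loops and multiple edges are allowed, the vertex and edge sets may be infinite, and degrees may be infinite. A connected graph has at least one vertex; it is regarded as a geodesic metric space by identifying every edge with the interval $[0,1]$ and taking as distance between two points (vertices or interior points of edges) the length of a shortest path joining them. A geodesic metric space $X$ is hyperbolic if there is $\delta\ge 0$ such that in every geodesic triangle of $X$ (three points joined pairwise by geodesics) each side is contained in the $\delta$-neighbourhood of the union of the two other sides. Deleting an edge $e$ from $G$ gives the graph $G\setminus e$ with the same vertices and all the edges except $e$. Contracting an edge $e$ with ends $A,B$ gives the graph $G/e$, in which $e$ is removed and $A$ and $B$ are merged into one vertex, all other edges being kept (so parallel edges and loops may arise; contracting a loop is the same as deleting it). **Theorem.** Let $G$ be a connected graph, and let $G'$ be a connected graph that is isomorphic to a graph obtained from $G$ by finitely many successive operations, each of which deletes or contracts one edge. Then $G$ is hyperbolic if and only if $G'$ is hyperbolic. -/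

import Mathlib

open scoped ENNReal

/-! ### Geodesic triangles and Gromov hyperbolicity (Rips condition) -/

/-- `S` is (the image of) a geodesic joining `x` and `y`: it is parametrized by arc length on some
interval `[0, L]`, and distances along it are distances in `X`. -/
def IsGeodesicBetween {X : Type*} [EMetricSpace X] (x y : X) (S : Set X) : Prop :=
  ∃ (L : ℝ) (γ : ℝ → X), 0 ≤ L ∧ γ 0 = x ∧ γ L = y ∧
    (∀ s ∈ Set.Icc 0 L, ∀ t ∈ Set.Icc 0 L, edist (γ s) (γ t) = ENNReal.ofReal |s - t|) ∧
    S = γ '' Set.Icc 0 L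

/-- `S` is contained in the `δ`-neighbourhood of `T`. -/
def IsWithin {X : Type*} [EMetricSpace X] (δ : ℝ) (S T : Set X) : Prop :=
  ∀ p ∈ S, ∃ q ∈ T, edist p q ≤ ENNReal.ofReal δ

/-- Every geodesic triangle of `X` is `δ`-thin: each of its sides is contained in the
`δ`-neighbourhood of the union of the two other sides. -/
def IsDeltaHyperbolic (X : Type*) [EMetricSpace X] (δ : ℝ) : Prop :=
  ∀ (x y z : X) (S₁ S₂ S₃ : Set X),
    IsGeodesicBetween x y S₁ → IsGeodesicBetween y z S₂ → IsGeodesicBetween z x S₃ →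
    IsWithin δ S₁ (S₂ ∪ S₃) ∧ IsWithin δ S₂ (S₃ ∪ S₁) ∧ IsWithin δ S₃ (S₁ ∪ S₂)

/-- A (geodesic) space is hyperbolic if it is `δ`-hyperbolic for some `δ ≥ 0`. -/
def IsHyperbolic (X : Type*) [EMetricSpace X] : Prop :=
  ∃ δ : ℝ, 0 ≤ δ ∧ IsDeltaHyperbolic X δ

namespace Graph

/-! ### Walks and connectedness of multigraphs (loops and multiple edges are allowed) -/

/-- There is a walk with exactly `n` edges from `x` to `y` in `G`. -/
inductive HasWalk {α β : Type*} (G : Graph α β) : ℕ → α → α → Prop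
  | nil {x : α} (hx : x ∈ V(G)) : HasWalk G 0 x x
  | cons {n : ℕ} {e : β} {x y z : α} (h : G.IsLink e x y) (w : HasWalk G n y z) :
      HasWalk G (n + 1) x z

/-- `G` has a vertex, and any two vertices are joined by a walk. -/
def IsConnected {α β : Type*} (G : Graph α β) : Prop :=
  V(G).Nonempty ∧ ∀ x ∈ V(G), ∀ y ∈ V(G), ∃ n, G.HasWalk n x y

/-- The length of a shortest walk between two vertices (`∞` if there is none). -/
noncomputable def vdist {α β : Type*} (G : Graph α β) (x y : α) : ℝ≥0∞ :=
  ⨅ (n : ℕ) (_ : G.HasWalk n x y), (n : ℝ≥0∞)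

section WalkLemmas

variable {α β : Type*} {G : Graph α β}

theorem HasWalk.append {m n : ℕ} {x y z : α} (h : G.HasWalk m x y) (k : G.HasWalk n y z) :
    G.HasWalk (m + n) x z := by
  induction h with
  | nil hx => simpa using k
  | cons h w ih =>
    have := HasWalk.cons h (ih k)
    rwa [Nat.add_right_comm] at this

theorem HasWalk.reverse {n : ℕ} {x y : α} (h : G.HasWalk n x y) : G.HasWalk n y x := by
  induction h with
  | nil hx => exact .nil hx
  | cons h w ih => exact ih.append (.cons h.symm (.nil h.left_mem))

theorem HasWalk.vdist_le {n : ℕ} {x y : α} (h : G.HasWalk n x y) : G.vdist x y ≤ n :=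
  iInf₂_le n h

theorem vdist_self {x : α} (hx : x ∈ V(G)) : G.vdist x x = 0 := by
  simpa using (HasWalk.nil hx).vdist_le

theorem vdist_comm (x y : α) : G.vdist x y = G.vdist y x :=
  le_antisymm (le_iInf₂ fun _ h => h.reverse.vdist_le) (le_iInf₂ fun _ h => h.reverse.vdist_le)

theorem vdist_triangle (x y z : α) : G.vdist x z ≤ G.vdist x y + G.vdist y z := by
  conv_rhs => unfold vdist
  refine ENNReal.le_iInf₂_add_iInf₂ fun m hm n hn => ?_
  exact_mod_cast (hm.append hn).vdist_le

theorem eq_of_vdist_eq_zero {x y : α} (h : G.vdist x y = 0) : x = y := by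
  have h1 : G.vdist x y < 1 := by rw [h]; exact one_pos
  obtain ⟨n, hn, hlt⟩ := by simpa only [vdist, iInf_lt_iff] using h1
  have : n = 0 := by
    have : n < 1 := by exact_mod_cast hlt
    omega
  subst this
  cases hn
  rfl

end WalkLemmas

/-! ### The metric graph

Every edge is identified with the interval `[0, 1]`. -/

/-- The first end of an edge, for an arbitrarily chosen direction of that edge. -/
noncomputable def src {α β : Type*} (G : Graph α β) (e : E(G)) : α :=
  (G.exists_isLink_of_mem_edgeSet e.2).choose

/-- The second end of an edge, for the same direction. -/
noncomputable def tgt {α β : Type*} (G : Graph α β) (e : E(G)) : α :=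
  (G.exists_isLink_of_mem_edgeSet e.2).choose_spec.choose

theorem isLink_src_tgt {α β : Type*} (G : Graph α β) (e : E(G)) :
    G.IsLink e (G.src e) (G.tgt e) :=
  (G.exists_isLink_of_mem_edgeSet e.2).choose_spec.choose_spec

/-- The points of `G` as a metric graph: its vertices, and the points in the interior of its
edges; `inner e t` is the point of `e` at distance `t` (along `e`) from `src e`. -/
inductive Point {α β : Type*} (G : Graph α β)
  | vertex (x : V(G)) : Point G
  | inner (e : E(G)) (t : Set.Ioo (0 : ℝ) 1) : Point G

namespace Point

variable {α β : Type*} {G : Graph α β}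

/-- The two ends of the edge on which a point lies (a vertex is its own end, twice). -/
noncomputable def endpt : Point G → Bool → α
  | vertex x, _ => x
  | inner e _, false => G.src e
  | inner e _, true => G.tgt e

/-- The length of the piece of edge from a point to the corresponding end. -/
noncomputable def cost : Point G → Bool → ℝ≥0∞
  | vertex _, _ => 0
  | inner _ t, false => ENNReal.ofReal t
  | inner _ t, true => ENNReal.ofReal (1 - t)

open Classical in
/-- The length of the piece of edge between two interior points of the same edge
(`∞` in all other cases). -/
noncomputable def along : Point G → Point G → ℝ≥0∞
  | inner e s, inner f t => if e = f then ENNReal.ofReal |(s : ℝ) - t| else ⊤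
  | _, _ => ⊤

/-- The length of a shortest path between two points of the metric graph: the path either stays
inside one edge, or leaves `p` through an end of its edge, goes from vertex to vertex, and
reaches `q` through an end of its edge. -/
noncomputable def pathDist (p q : Point G) : ℝ≥0∞ :=
  min (along p q) (⨅ (i : Bool) (j : Bool), p.cost i + G.vdist (p.endpt i) (q.endpt j) + q.cost j)

theorem endpt_mem (p : Point G) (i : Bool) : p.endpt i ∈ V(G) := by
  rcases p with x | ⟨e, t⟩
  · exact x.2
  · cases i
    · exact (G.isLink_src_tgt e).left_mem
    · exact (G.isLink_src_tgt e).right_mem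

theorem along_comm (p q : Point G) : along p q = along q p := by
  rcases p with x | ⟨e, s⟩ <;> rcases q with y | ⟨f, t⟩ <;> simp only [along]
  by_cases h : e = f
  · subst h; simp [abs_sub_comm]
  · simp [h, Ne.symm h]

theorem along_triangle (p q r : Point G) : along p r ≤ along p q + along q r := by
  rcases p with x | ⟨e, s⟩ <;> rcases q with y | ⟨f, t⟩ <;> rcases r with z | ⟨g, u⟩ <;>
    simp only [along, top_add, add_top, le_top]
  by_cases h : e = f
  · by_cases h' : f = g
    · subst h; subst h'
      simp only [if_true]
      rw [← ENNReal.ofReal_add (abs_nonneg _) (abs_nonneg _)]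
      exact ENNReal.ofReal_le_ofReal (abs_sub_le _ _ _)
    · simp [h']
  · simp [h]

theorem cost_le_along (p q : Point G) (i : Bool) (z : α) :
    p.cost i + G.vdist (p.endpt i) z ≤ along p q + (q.cost i + G.vdist (q.endpt i) z) := by
  rcases p with x | ⟨e, s⟩ <;> rcases q with y | ⟨f, t⟩ <;>
    simp only [along, top_add, le_top]
  by_cases h : e = f
  · subst h
    rw [← add_assoc]
    cases i <;> simp only [cost, endpt, if_true] <;> gcongr <;>
      rw [← ENNReal.ofReal_add (abs_nonneg _) (by linarith [t.2.1, t.2.2])] <;>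
      apply ENNReal.ofReal_le_ofReal
    · linarith [le_abs_self ((s : ℝ) - t)]
    · linarith [neg_abs_le ((s : ℝ) - t)]
  · simp [h]

theorem vdist_endpt_le (q : Point G) (i j : Bool) :
    G.vdist (q.endpt i) (q.endpt j) ≤ q.cost i + q.cost j := by
  by_cases hij : i = j
  · subst hij; rw [vdist_self (q.endpt_mem i)]; exact zero_le
  rcases q with x | ⟨e, t⟩
  · simp [endpt, vdist_self x.2]
  have h0 := t.2.1.le
  have h1 : (0 : ℝ) ≤ 1 - t := by linarith [t.2.2]
  have hl := G.isLink_src_tgt e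
  have key : G.vdist (G.src e) (G.tgt e) ≤ 1 := by
    simpa using (HasWalk.cons hl (.nil hl.right_mem)).vdist_le
  have hs : ENNReal.ofReal (t : ℝ) + ENNReal.ofReal (1 - t) = 1 := by
    rw [← ENNReal.ofReal_add h0 h1]; simp
  cases i <;> cases j <;> simp only [endpt, cost] <;> first | exact absurd rfl hij | skip
  · rwa [hs]
  · rwa [add_comm, hs, vdist_comm]

theorem pathDist_self (p : Point G) : pathDist p p = 0 := by
  apply le_antisymm _ zero_le
  rcases p with x | ⟨e, t⟩
  · refine (min_le_right _ _).trans ((iInf₂_le false false).trans ?_)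
    simp [cost, endpt, vdist_self x.2]
  · refine (min_le_left _ _).trans ?_
    simp [along]

theorem pathDist_le_comm (p q : Point G) : pathDist p q ≤ pathDist q p := by
  refine le_min ((min_le_left _ _).trans_eq (along_comm p q)) (le_iInf₂ fun i j => ?_)
  refine (min_le_right _ _).trans ((iInf₂_le j i).trans_eq ?_)
  rw [vdist_comm]; ring

theorem exists_pathDist_eq (p q : Point G) : pathDist p q = along p q ∨
    ∃ i j, pathDist p q = p.cost i + G.vdist (p.endpt i) (q.endpt j) + q.cost j := by
  rcases min_choice (along p q)
    (⨅ (i : Bool) (j : Bool), p.cost i + G.vdist (p.endpt i) (q.endpt j) + q.cost j) with h | h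
  · exact .inl h
  · right
    obtain ⟨i, hi⟩ := exists_eq_ciInf_of_finite
      (f := fun i : Bool => ⨅ j : Bool, p.cost i + G.vdist (p.endpt i) (q.endpt j) + q.cost j)
    obtain ⟨j, hj⟩ := exists_eq_ciInf_of_finite
      (f := fun j : Bool => p.cost i + G.vdist (p.endpt i) (q.endpt j) + q.cost j)
    exact ⟨i, j, by rw [pathDist, h, ← hi, ← hj]⟩

theorem pathDist_le (p q : Point G) (i j : Bool) :
    pathDist p q ≤ p.cost i + G.vdist (p.endpt i) (q.endpt j) + q.cost j :=
  (min_le_right _ _).trans (iInf_le_of_le i (iInf_le _ j))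

theorem pathDist_triangle (p q r : Point G) : pathDist p r ≤ pathDist p q + pathDist q r := by
  rcases exists_pathDist_eq p q with h | ⟨i, j, h⟩ <;>
    rcases exists_pathDist_eq q r with k | ⟨i', j', k⟩ <;> rw [h, k]
  · exact (min_le_left _ _).trans (along_triangle p q r)
  · refine (pathDist_le p r i' j').trans ?_
    calc _ ≤ along p q + (q.cost i' + G.vdist (q.endpt i') (r.endpt j')) + r.cost j' :=
          add_le_add_left (cost_le_along p q i' _) _
      _ = _ := by ring
  · refine (pathDist_le p r i j).trans ?_
    have := cost_le_along r q j (p.endpt i)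
    rw [vdist_comm (r.endpt j), vdist_comm (q.endpt j), along_comm] at this
    calc _ = p.cost i + (r.cost j + G.vdist (p.endpt i) (r.endpt j)) := by ring
      _ ≤ p.cost i + (along q r + (q.cost j + G.vdist (p.endpt i) (q.endpt j))) := by gcongr
      _ = _ := by ring
  · refine (pathDist_le p r i j').trans ?_
    calc _ ≤ p.cost i + (G.vdist (p.endpt i) (q.endpt j) +
            ((q.cost j + q.cost i') + G.vdist (q.endpt i') (r.endpt j'))) + r.cost j' := by
          gcongr
          refine (vdist_triangle _ (q.endpt j) _).trans ?_
          gcongr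
          refine (vdist_triangle _ (q.endpt i') _).trans ?_
          gcongr
          exact vdist_endpt_le q j i'
      _ = _ := by ring

theorem eq_vertex_of_cost_eq_zero {p : Point G} {i : Bool} (h : p.cost i = 0) :
    ∃ x, p = vertex x := by
  rcases p with x | ⟨e, t⟩
  · exact ⟨x, rfl⟩
  · cases i
    · have := ENNReal.ofReal_eq_zero.1 h
      exact absurd this (not_le.2 t.2.1)
    · have := ENNReal.ofReal_eq_zero.1 h
      exact absurd t.2.2 (by linarith)

theorem eq_of_pathDist_eq_zero {p q : Point G} (h0 : pathDist p q = 0) : p = q := by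
  rcases exists_pathDist_eq p q with h | ⟨i, j, h⟩ <;> rw [h0] at h
  · rcases p with x | ⟨e, s⟩ <;> rcases q with y | ⟨f, t⟩ <;> simp only [along] at h <;>
      first | exact absurd h (by simp) | skip
    by_cases hef : e = f
    · subst hef
      rw [if_pos rfl, eq_comm, ENNReal.ofReal_eq_zero] at h
      have : (s : ℝ) = t := sub_eq_zero.1 (abs_nonpos_iff.1 h)
      rw [Subtype.ext this]
    · simp [hef] at h
  · obtain ⟨⟨hp, hv⟩, hq⟩ : (p.cost i = 0 ∧ G.vdist (p.endpt i) (q.endpt j) = 0) ∧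
        q.cost j = 0 := by simpa [add_eq_zero] using h.symm
    obtain ⟨x, rfl⟩ := eq_vertex_of_cost_eq_zero hp
    obtain ⟨y, rfl⟩ := eq_vertex_of_cost_eq_zero hq
    rw [Subtype.ext (eq_of_vdist_eq_zero hv : (x : α) = y)]

/-- The metric graph, with its length distance (`∞` between different components). -/
noncomputable instance : EMetricSpace (Point G) where
  edist := pathDist
  edist_self := pathDist_self
  edist_comm p q := le_antisymm (pathDist_le_comm p q) (pathDist_le_comm q p)
  edist_triangle := pathDist_triangle
  eq_of_edist_eq_zero := eq_of_pathDist_eq_zero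

end Point

/-! ### Deletion and contraction of edges, minors -/

open Classical in
/-- The graph obtained by contracting an edge `e` with ends `x` and `y`: `y` is merged into `x`
and `e` is removed. All other edges are kept, so that edges parallel to `e` become loops. -/
noncomputable def contractEdge {α β : Type*} (G : Graph α β) (e : β) (x y : α) : Graph α β :=
  (G.map fun v => if v = y then x else v).deleteEdges {e}

/-- One edge is removed, or one edge is contracted. -/
inductive MinorStep {α β : Type*} (G : Graph α β) : Graph α β → Prop
  | delete {e : β} (he : e ∈ E(G)) : MinorStep G (G.deleteEdges {e})
  | contract {e : β} {x y : α} (h : G.IsLink e x y) : MinorStep G (G.contractEdge e x y)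

/-- `G` and `H` are isomorphic multigraphs. -/
def IsIsomorphic {α β α' β' : Type*} (G : Graph α β) (H : Graph α' β') : Prop :=
  ∃ (f : V(G) ≃ V(H)) (g : E(G) ≃ E(H)), ∀ (e : E(G)) (x y : V(G)),
    G.IsLink e x y ↔ H.IsLink (g e) (f x) (f y)

/-- `G'` is, up to isomorphism, obtained from `G` by removing and/or contracting finitely many
edges, one after the other. -/
def IsFiniteEdgeMinor {α β α' β' : Type*} (G : Graph α β) (G' : Graph α' β') : Prop :=
  ∃ H : Graph α β, Relation.ReflTransGen MinorStep G H ∧ IsIsomorphic H G'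

end Graph

/-! Hyperbolicity is traded for Gromov's four-point condition on the vertex set with the path
metric. A four-point inequality compares sums of two distances, so it survives, with a larger
constant, any change of all distances by a bounded additive error. This makes the appeal to
quasi-isometry invariance, and hence to stability of quasi-geodesics, unnecessary.

Each operation does change distances only by a bounded additive amount. A walk may cross the edge
`e` many times, but the part between its first and last visit to the ends of `e` can be replaced by
a single connection. For a contraction this connection is at most `e` itself, at cost 1; for a
deletion it is at most a fixed detour in the remaining graph, which exists if that graph is
connected (`exists_isRoughSurjection_contractEdge`, `exists_isRoughSurjection_deleteEdges`).
Connectedness is known only for the two extreme graphs, but it passes backwards through every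
operation, so the induction starts from the last graph.

The equivalence with thin triangles is `IsConnected.isHyperbolic_iff_fourPoint`. From four points to
triangles, a point on one side almost realizes the length of another side and is therefore close to
it. Conversely, the distance from a point to a geodesic is, up to a constant, a Gromov product, and
thinness compares these products. -/

/-! ### The four-point condition -/

/-- Gromov's four-point condition, with an unspecified constant. -/
def FourPoint {X : Type*} (d : X → X → ℝ) : Prop :=
  ∃ c : ℝ, ∀ x y z w, d x z + d y w ≤ max (d x y + d z w) (d y z + d x w) + c

theorem FourPoint.comap {X Y : Type*} {d : X → X → ℝ} {d' : Y → Y → ℝ} (h : FourPoint d')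
    (f : X → Y) {C : ℝ} (hf : ∀ x y, |d x y - d' (f x) (f y)| ≤ C) : FourPoint d := by
  obtain ⟨c, hc⟩ := h
  -- Each side of the inequality is a sum of two distances and moves by at most `2 * C`.
  refine ⟨c + 4 * C, fun x y z w => ?_⟩
  have key := hc (f x) (f y) (f z) (f w)
  have h1 := abs_le.1 (hf x z)
  have h2 := abs_le.1 (hf y w)
  have h3 := abs_le.1 (hf x y)
  have h4 := abs_le.1 (hf z w)
  have h5 := abs_le.1 (hf y z)
  have h6 := abs_le.1 (hf x w)
  rcases le_total (d' (f x) (f y) + d' (f z) (f w)) (d' (f y) (f z) + d' (f x) (f w)) with h | h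
  · rw [max_eq_right h] at key
    linarith [le_max_right (d x y + d z w) (d y z + d x w)]
  · rw [max_eq_left h] at key
    linarith [le_max_left (d x y + d z w) (d y z + d x w)]

/-- A right inverse of `f` distorts distances by no more than `f` does, so `FourPoint.comap` applies
in both directions. -/
theorem fourPoint_iff_of_surjective {X Y : Type*} {d : X → X → ℝ} {d' : Y → Y → ℝ} (f : X → Y)
    (hsurj : Function.Surjective f) {C : ℝ} (hf : ∀ x y, |d x y - d' (f x) (f y)| ≤ C) :
    FourPoint d ↔ FourPoint d' := by
  refine ⟨fun h => ?_, fun h => h.comap f hf⟩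
  obtain ⟨g, hg⟩ := hsurj.hasRightInverse
  refine h.comap g (C := C) fun x y => ?_
  have := hf (g x) (g y)
  rwa [hg, hg, abs_sub_comm] at this

/-! ### Real-valued distances -/

/-- The real-valued distance of an extended metric space. -/
noncomputable def rdist {X : Type*} [EMetricSpace X] (x y : X) : ℝ := (edist x y).toReal

section

variable {X : Type*} [EMetricSpace X]

theorem rdist_nonneg (x y : X) : 0 ≤ rdist x y := ENNReal.toReal_nonneg

theorem rdist_self (x : X) : rdist x x = 0 := by simp [rdist]

theorem rdist_comm (x y : X) : rdist x y = rdist y x := by rw [rdist, edist_comm, rdist]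

theorem rdist_triangle (hfin : ∀ x y : X, edist x y ≠ ⊤) (x y z : X) :
    rdist x z ≤ rdist x y + rdist y z := by
  unfold rdist
  rw [← ENNReal.toReal_add (hfin _ _) (hfin _ _)]
  exact ENNReal.toReal_mono (ENNReal.add_ne_top.2 ⟨hfin _ _, hfin _ _⟩) (edist_triangle _ _ _)

theorem edist_le_ofReal_of_rdist_le {x y : X} (h : edist x y ≠ ⊤) {r : ℝ} (hr : rdist x y ≤ r) :
    edist x y ≤ ENNReal.ofReal r := by
  rw [← ENNReal.ofReal_toReal h]
  exact ENNReal.ofReal_le_ofReal hr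

theorem rdist_le_of_edist_le {x y : X} {r : ℝ} (hr : 0 ≤ r) (h : edist x y ≤ ENNReal.ofReal r) :
    rdist x y ≤ r :=
  ENNReal.toReal_le_of_le_ofReal hr h

theorem IsGeodesicBetween.symm {x y : X} {S : Set X} (h : IsGeodesicBetween x y S) :
    IsGeodesicBetween y x S := by
  obtain ⟨L, γ, hL, h0, h1, hd, rfl⟩ := h
  refine ⟨L, fun t => γ (L - t), hL, by simpa, by simpa, fun s hs t ht => ?_, ?_⟩
  · rw [hd _ ⟨by linarith [hs.2], by linarith [hs.1]⟩ _ ⟨by linarith [ht.2], by linarith [ht.1]⟩,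
      abs_sub_comm]
    congr 2
    ring
  · ext p
    constructor <;> rintro ⟨t, ht, rfl⟩ <;>
      exact ⟨L - t, ⟨by linarith [ht.2], by linarith [ht.1]⟩, by simp⟩

/-- A geodesic, in terms of the real-valued distance. -/
theorem IsGeodesicBetween.exists_param {x y : X} {S : Set X} (h : IsGeodesicBetween x y S) :
    ∃ γ : ℝ → X, γ 0 = x ∧ γ (rdist x y) = y ∧
      (∀ s ∈ Set.Icc 0 (rdist x y), ∀ t ∈ Set.Icc 0 (rdist x y), rdist (γ s) (γ t) = |s - t|) ∧
      S = γ '' Set.Icc 0 (rdist x y) := by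
  obtain ⟨L, γ, hL, h0, h1, hd, rfl⟩ := h
  have hLd : rdist x y = L := by
    rw [rdist, ← h0, ← h1, hd 0 ⟨le_rfl, hL⟩ L ⟨hL, le_rfl⟩, ENNReal.toReal_ofReal (abs_nonneg _)]
    simp [abs_of_nonneg hL]
  refine ⟨γ, h0, by rwa [hLd], fun s hs t ht => ?_, by rw [hLd]⟩
  rw [hLd] at hs ht
  rw [rdist, hd s hs t ht, ENNReal.toReal_ofReal (abs_nonneg _)]

theorem IsGeodesicBetween.exists_rdist_eq {x y : X} {S : Set X} (h : IsGeodesicBetween x y S)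
    {t : ℝ} (ht : t ∈ Set.Icc 0 (rdist x y)) :
    ∃ p ∈ S, rdist x p = t ∧ rdist p y = rdist x y - t := by
  obtain ⟨γ, h0, h1, hd, rfl⟩ := h.exists_param
  have hL := rdist_nonneg x y
  refine ⟨γ t, ⟨t, ht, rfl⟩, ?_, ?_⟩
  · have := hd 0 ⟨le_rfl, hL⟩ t ht
    rwa [h0, zero_sub, abs_neg, abs_of_nonneg ht.1] at this
  · have := hd t ht _ ⟨hL, le_rfl⟩
    rwa [h1, abs_sub_comm, abs_of_nonneg (sub_nonneg.2 ht.2)] at this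

theorem IsGeodesicBetween.rdist_add_rdist {x y p : X} {S : Set X} (h : IsGeodesicBetween x y S)
    (hp : p ∈ S) : rdist x p + rdist p y = rdist x y := by
  obtain ⟨γ, h0, h1, hd, rfl⟩ := h.exists_param
  obtain ⟨t, ht, rfl⟩ := hp
  have hL := rdist_nonneg x y
  have e1 := hd 0 ⟨le_rfl, hL⟩ t ht
  have e2 := hd t ht _ ⟨hL, le_rfl⟩
  rw [h0, zero_sub, abs_neg, abs_of_nonneg ht.1] at e1
  rw [h1, abs_sub_comm, abs_of_nonneg (sub_nonneg.2 ht.2)] at e2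
  linarith

theorem IsGeodesicBetween.left_mem {x y : X} {S : Set X} (h : IsGeodesicBetween x y S) :
    x ∈ S := by
  obtain ⟨L, γ, hL, rfl, -, -, rfl⟩ := h
  exact ⟨0, ⟨le_rfl, hL⟩, rfl⟩

/-! ### The four-point condition implies that triangles are thin -/

/-- Under the four-point condition, a point that almost realizes the distance from `x` to `z`
is close to any geodesic from `x` to `z`. -/
theorem exists_rdist_le_of_rdist_add_le {c : ℝ} (hc0 : 0 ≤ c)
    (hc : ∀ x y z w : X, rdist x z + rdist y w ≤
      max (rdist x y + rdist z w) (rdist y z + rdist x w) + c)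
    {x z p : X} {S : Set X} (hS : IsGeodesicBetween x z S)
    (hp : rdist x p + rdist p z ≤ rdist x z + c) : ∃ q ∈ S, rdist p q ≤ 2 * c := by
  rcases le_total (rdist x p) (rdist x z) with h | h
  -- The point of the geodesic at the same distance from `x` as `p`. In the four-point inequality
  -- for `p, x, q, z` both alternatives on the right are then at most `rdist x z + c`.
  · obtain ⟨q, hq, hxq, hqz⟩ := hS.exists_rdist_eq ⟨rdist_nonneg x p, h⟩
    refine ⟨q, hq, ?_⟩
    have := hc p x q z
    rw [rdist_comm p x] at this
    have hm : max (rdist x p + rdist q z) (rdist x q + rdist p z) ≤ rdist x z + c :=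
      max_le (by linarith) (by linarith)
    linarith
  · exact ⟨z, hS.symm.left_mem, by linarith⟩

/-- Since `p` splits `rdist x y` exactly, the four-point inequality for `x, z, y, p` loses `rdist x
p` or `rdist p y` on both sides. What remains says that `p` almost realizes the distance from `y` to
`z` or from `x` to `z`. -/
theorem isWithin_of_fourPoint (hfin : ∀ x y : X, edist x y ≠ ⊤) {c : ℝ} (hc0 : 0 ≤ c)
    (hc : ∀ x y z w : X, rdist x z + rdist y w ≤
      max (rdist x y + rdist z w) (rdist y z + rdist x w) + c)
    {x y z : X} {S₁ S₂ S₃ : Set X} (h₁ : IsGeodesicBetween x y S₁)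
    (h₂ : IsGeodesicBetween y z S₂) (h₃ : IsGeodesicBetween z x S₃) :
    IsWithin (2 * c) S₁ (S₂ ∪ S₃) := by
  intro p hp
  have hxy := h₁.rdist_add_rdist hp
  have key := hc x z y p
  have c1 := rdist_comm z p
  have c2 := rdist_comm y p
  have c3 := rdist_comm z y
  have c4 := rdist_comm z x
  rcases le_total (rdist x z + rdist y p) (rdist z y + rdist x p) with h | h
  · rw [max_eq_right h] at key
    obtain ⟨q, hq, hpq⟩ := exists_rdist_le_of_rdist_add_le hc0 hc (p := p) h₂ (by linarith)
    exact ⟨q, .inl hq, edist_le_ofReal_of_rdist_le (hfin _ _) hpq⟩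
  · rw [max_eq_left h] at key
    obtain ⟨q, hq, hpq⟩ := exists_rdist_le_of_rdist_add_le hc0 hc (p := p) h₃.symm (by linarith)
    exact ⟨q, .inr hq, edist_le_ofReal_of_rdist_le (hfin _ _) hpq⟩

theorem isHyperbolic_of_fourPoint (hfin : ∀ x y : X, edist x y ≠ ⊤)
    (h : FourPoint (rdist : X → X → ℝ)) : IsHyperbolic X := by
  obtain ⟨c, hc⟩ := h
  have hc' : ∀ x y z w : X, rdist x z + rdist y w ≤
      max (rdist x y + rdist z w) (rdist y z + rdist x w) + max c 0 := fun x y z w =>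
    (hc x y z w).trans (by gcongr; exact le_max_left _ _)
  -- Taking four equal points shows `0 ≤ c` unless the space is empty; the maximum avoids the
  -- distinction.
  have h0 : 0 ≤ max c 0 := le_max_right _ _
  exact ⟨2 * max c 0, by positivity, fun x y z S₁ S₂ S₃ h₁ h₂ h₃ =>
    ⟨isWithin_of_fourPoint hfin h0 hc' h₁ h₂ h₃, isWithin_of_fourPoint hfin h0 hc' h₂ h₃ h₁,
      isWithin_of_fourPoint hfin h0 hc' h₃ h₁ h₂⟩⟩

/-! ### Thin triangles imply the four-point condition -/

/-- If `[0, L]` is covered by two sets containing `0` and `L` respectively, then the two sets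
contain points at distance at most `1`. -/
theorem exists_abs_sub_le_one {L : ℝ} (hL : 0 ≤ L) {A B : Set ℝ}
    (hcov : ∀ t ∈ Set.Icc 0 L, t ∈ A ∨ t ∈ B) (h0 : 0 ∈ A) (h1 : L ∈ B) :
    ∃ a ∈ A ∩ Set.Icc 0 L, ∃ b ∈ B ∩ Set.Icc 0 L, |a - b| ≤ 1 := by
  have hbdd : BddAbove (A ∩ Set.Icc 0 L) := ⟨L, fun t ht => ht.2.2⟩
  have hmem0 : (0 : ℝ) ∈ A ∩ Set.Icc 0 L := ⟨h0, le_rfl, hL⟩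
  obtain ⟨a, ha, hlt⟩ := exists_lt_of_lt_csSup ⟨0, hmem0⟩
    (sub_lt_self (sSup (A ∩ Set.Icc 0 L)) (one_half_pos (α := ℝ)))
  have hle := le_csSup hbdd ha
  have hs0 := le_csSup hbdd hmem0
  -- The sets need not be closed, so the supremum of `A` is missed by up to 1/2 on either side: `a`
  -- lies just below it, and a point 1/2 above it can no longer be in `A`. If that point exceeds
  -- `L`, the end `L` serves instead.
  refine ⟨a, ha, min L (sSup (A ∩ Set.Icc 0 L) + 1 / 2), ⟨?_, le_min hL (by linarith),
    min_le_left _ _⟩, ?_⟩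
  · rcases le_total L (sSup (A ∩ Set.Icc 0 L) + 1 / 2) with h | h
    · rwa [min_eq_left h]
    · rw [min_eq_right h]
      have hI : sSup (A ∩ Set.Icc 0 L) + 1 / 2 ∈ Set.Icc 0 L := ⟨by linarith, h⟩
      refine (hcov _ hI).resolve_left fun hA => ?_
      linarith [le_csSup hbdd ⟨hA, hI⟩]
  · rw [abs_le]
    refine ⟨?_, ?_⟩
    · linarith [min_le_right L (sSup (A ∩ Set.Icc 0 L) + 1 / 2)]
    · have : a ≤ min L (sSup (A ∩ Set.Icc 0 L) + 1 / 2) := le_min ha.2.2 (by linarith)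
      linarith

/-- In a thin triangle with vertex `w`, the opposite side passes close to `w`, at distance about
the Gromov product. -/
theorem IsDeltaHyperbolic.exists_two_mul_rdist_le (hfin : ∀ x y : X, edist x y ≠ ⊤) {δ : ℝ}
    (hδ : 0 ≤ δ) (h : IsDeltaHyperbolic X δ) {x y w : X} {S T U : Set X}
    (hS : IsGeodesicBetween x y S) (hT : IsGeodesicBetween y w T)
    (hU : IsGeodesicBetween w x U) :
    ∃ p ∈ S, 2 * rdist w p ≤ rdist w x + rdist w y - rdist x y + 4 * δ + 2 := by
  have hthin := (h x y w S T U hS hT hU).1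
  obtain ⟨γ, h0, h1, hd, rfl⟩ := hS.exists_param
  have hL := rdist_nonneg x y
  obtain ⟨a, ⟨⟨q, hq, hqd⟩, haI⟩, b, ⟨⟨r, hr, hrd⟩, hbI⟩, hab⟩ := exists_abs_sub_le_one hL
    (A := {t | ∃ q ∈ U, rdist (γ t) q ≤ δ}) (B := {t | ∃ q ∈ T, rdist (γ t) q ≤ δ})
    (fun t ht => by
      obtain ⟨q, hq | hq, hd⟩ := hthin (γ t) ⟨t, ht, rfl⟩
      · exact .inr ⟨q, hq, rdist_le_of_edist_le hδ hd⟩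
      · exact .inl ⟨q, hq, rdist_le_of_edist_le hδ hd⟩)
    ⟨x, hU.symm.left_mem, by rwa [h0, rdist_self]⟩ ⟨y, hT.left_mem, by rwa [h1, rdist_self]⟩
  -- `γ a` is within `δ` of `q` on `U` and within `δ + 1` of `r` on `T`. Going through `q` bounds
  -- its distance to `w` by `rdist w x - rdist x (γ a) + 2 * δ`; going through `r` gives the
  -- analogous bound for `y` with `2 * δ + 2`. The two bounds are added.
  refine ⟨γ a, ⟨a, haI, rfl⟩, ?_⟩
  have e1 := hU.rdist_add_rdist hq
  have e2 := hT.rdist_add_rdist hr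
  have e3 := hd a haI b hbI
  have e4 := hS.rdist_add_rdist (p := γ a) ⟨a, haI, rfl⟩
  have t1 := rdist_triangle hfin w q (γ a)
  have t2 := rdist_triangle hfin (γ a) q x
  have t3 := rdist_triangle hfin w r (γ a)
  have t4 := rdist_triangle hfin (γ a) r y
  have t5 := rdist_triangle hfin (γ a) (γ b) r
  simp only [rdist_comm q (γ a), rdist_comm r (γ a), rdist_comm r y, rdist_comm r w,
    rdist_comm y w, rdist_comm (γ a) x] at *
  linarith

/-- The converse estimate, by two triangle inequalities: no point of a geodesic is nearer to `w`
than the Gromov product of its ends. -/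
theorem two_mul_rdist_ge (hfin : ∀ x y : X, edist x y ≠ ⊤) {x y p : X} (w : X) {S : Set X}
    (hS : IsGeodesicBetween x y S) (hp : p ∈ S) :
    rdist w x + rdist w y - rdist x y ≤ 2 * rdist w p := by
  have e := hS.rdist_add_rdist hp
  have t1 := rdist_triangle hfin w p x
  have t2 := rdist_triangle hfin w p y
  rw [rdist_comm p x] at t1
  linarith

/-- The side from `x` to `z` has a point `p` whose distance to `w` is about the Gromov product of
`x` and `z`. Thinness puts `p` near a side ending at `y`, and the Gromov product of the ends of that
side bounds the distance from below. The family `f` restricts the need for geodesics to chosen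
points. -/
theorem IsHyperbolic.fourPoint (hfin : ∀ x y : X, edist x y ≠ ⊤) (h : IsHyperbolic X)
    {ι : Type*} (f : ι → X) (hgeo : ∀ i j, ∃ S, IsGeodesicBetween (f i) (f j) S) :
    FourPoint fun i j => rdist (f i) (f j) := by
  obtain ⟨δ, hδ, h⟩ := h
  -- `4 * δ + 2` comes from the choice of `p`, and `2 * δ` from moving `p` to `q` in an estimate of
  -- twice the distance.
  refine ⟨6 * δ + 2, fun x y z w => ?_⟩
  dsimp only
  obtain ⟨S, hS⟩ := hgeo x z
  obtain ⟨T, hT⟩ := hgeo z w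
  obtain ⟨U, hU⟩ := hgeo w x
  obtain ⟨Y, hY⟩ := hgeo z y
  obtain ⟨Z, hZ⟩ := hgeo y x
  obtain ⟨p, hp, hpw⟩ := h.exists_two_mul_rdist_le hfin hδ hS hT hU
  obtain ⟨q, hq, hpq⟩ := (h _ _ _ S Y Z hS hY hZ).1 p hp
  have hpq := rdist_le_of_edist_le hδ hpq
  have m1 := le_max_left (rdist (f x) (f y) + rdist (f z) (f w))
    (rdist (f y) (f z) + rdist (f x) (f w))
  have m2 := le_max_right (rdist (f x) (f y) + rdist (f z) (f w))
    (rdist (f y) (f z) + rdist (f x) (f w))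
  have c1 := rdist_comm (f w) (f x)
  have c2 := rdist_comm (f w) (f y)
  have c3 := rdist_comm (f w) (f z)
  have c4 := rdist_comm (f y) (f z)
  have c5 := rdist_comm (f x) (f y)
  have t := rdist_triangle hfin (f w) p q
  rcases hq with hq | hq
  · linarith [two_mul_rdist_ge hfin (f w) hY hq]
  · linarith [two_mul_rdist_ge hfin (f w) hZ hq]

end

namespace Graph

/-! ### The vertex metric -/

section VertexMetric

variable {α β : Type*} {G : Graph α β}

theorem HasWalk.left_mem {n : ℕ} {x y : α} (h : G.HasWalk n x y) : x ∈ V(G) := by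
  cases h with
  | nil hx => exact hx
  | cons h w => exact h.left_mem

theorem HasWalk.right_mem {n : ℕ} {x y : α} (h : G.HasWalk n x y) : y ∈ V(G) :=
  h.reverse.left_mem

theorem HasWalk.exists_vdist_eq {k : ℕ} {x y : α} (h : G.HasWalk k x y) :
    ∃ n : ℕ, G.HasWalk n x y ∧ G.vdist x y = n := by
  classical
  have hex : ∃ n, G.HasWalk n x y := ⟨k, h⟩
  refine ⟨Nat.find hex, Nat.find_spec hex, le_antisymm (Nat.find_spec hex).vdist_le ?_⟩
  exact le_iInf₂ fun n hn => by exact_mod_cast Nat.find_min' hex hn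

theorem IsConnected.exists_vdist_eq (hG : G.IsConnected) (x y : V(G)) :
    ∃ n : ℕ, G.HasWalk n x y ∧ G.vdist x y = n :=
  (hG.2 x x.2 y y.2).elim fun _ h => h.exists_vdist_eq

/-- The real-valued distance between vertices. -/
noncomputable def rvdist (G : Graph α β) (x y : V(G)) : ℝ := (G.vdist x y).toReal

theorem HasWalk.rvdist_le {n : ℕ} {x y : V(G)} (h : G.HasWalk n x y) : G.rvdist x y ≤ n := by
  simpa [rvdist] using ENNReal.toReal_mono (ENNReal.natCast_ne_top n) h.vdist_le

theorem IsConnected.exists_rvdist_eq (hG : G.IsConnected) (x y : V(G)) :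
    ∃ n : ℕ, G.HasWalk n x y ∧ G.rvdist x y = n := by
  obtain ⟨n, hn, h⟩ := hG.exists_vdist_eq x y
  exact ⟨n, hn, by rw [rvdist, h, ENNReal.toReal_natCast]⟩

end VertexMetric

/-! ### Rough isometries between vertex sets -/

/-- A surjection between vertex sets under which walks can be carried over in both directions,
at the expense of at most `C` additional edges. -/
structure IsRoughSurjection {α β α' β' : Type*} (G : Graph α β) (H : Graph α' β')
    (f : V(G) → V(H)) (C : ℕ) : Prop where
  surjective : Function.Surjective f
  push : ∀ {n : ℕ} {x y : V(G)}, G.HasWalk n x y → ∃ m ≤ n + C, H.HasWalk m (f x) (f y)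
  pull : ∀ {n : ℕ} {x y : V(G)}, H.HasWalk n (f x) (f y) → ∃ m ≤ n + C, G.HasWalk m x y

section RoughSurjection

variable {α β α' β' : Type*} {G : Graph α β} {H : Graph α' β'} {f : V(G) → V(H)} {C : ℕ}

/-- This direction, from target to source, makes all intermediate graphs of a minor sequence
connected. -/
theorem IsRoughSurjection.isConnected (h : IsRoughSurjection G H f C) (hH : H.IsConnected) :
    G.IsConnected := by
  obtain ⟨⟨v, hv⟩, hw⟩ := hH
  obtain ⟨x, -⟩ := h.surjective ⟨v, hv⟩
  refine ⟨⟨x, x.2⟩, fun a ha b hb => ?_⟩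
  obtain ⟨n, hn⟩ := hw _ (f ⟨a, ha⟩).2 _ (f ⟨b, hb⟩).2
  obtain ⟨m, -, hm⟩ := h.pull hn
  exact ⟨m, hm⟩

/-- Carrying over shortest walks in both directions shows that corresponding distances differ by at
most `C`. -/
theorem IsRoughSurjection.fourPoint_iff (h : IsRoughSurjection G H f C) (hH : H.IsConnected) :
    FourPoint G.rvdist ↔ FourPoint H.rvdist := by
  refine fourPoint_iff_of_surjective f h.surjective (C := C) fun x y => ?_
  obtain ⟨n, hn, hnd⟩ := (h.isConnected hH).exists_rvdist_eq x y
  obtain ⟨m, hm, hmd⟩ := hH.exists_rvdist_eq (f x) (f y)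
  obtain ⟨n', hn', hw⟩ := h.push hn
  obtain ⟨m', hm', hw'⟩ := h.pull hm
  have h1 : (n' : ℝ) ≤ n + C := by exact_mod_cast hn'
  have h2 : (m' : ℝ) ≤ m + C := by exact_mod_cast hm'
  rw [abs_le]
  constructor <;> linarith [hw.rvdist_le, hw'.rvdist_le]

end RoughSurjection

/-! ### Isomorphisms -/

section Isomorphic

variable {α β α' β' : Type*} {G : Graph α β} {H : Graph α' β'}

theorem HasWalk.map_of_isLink {n : ℕ} {x y : α} (h : G.HasWalk n x y) {f : V(G) → V(H)}
    {g : E(G) → E(H)} (hfg : ∀ (e : E(G)) (x y : V(G)), G.IsLink e x y →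
      H.IsLink (g e) (f x) (f y)) : H.HasWalk n (f ⟨x, h.left_mem⟩) (f ⟨y, h.right_mem⟩) := by
  induction h with
  | nil hx => exact .nil (f ⟨_, hx⟩).2
  | cons h w ih =>
    exact .cons (hfg ⟨_, h.edge_mem⟩ ⟨_, h.left_mem⟩ ⟨_, h.right_mem⟩ h) ih

theorem IsIsomorphic.exists_isRoughSurjection (h : IsIsomorphic G H) :
    ∃ f, IsRoughSurjection G H f 0 := by
  obtain ⟨f, g, hfg⟩ := h
  refine ⟨f, f.surjective, fun {n x y} hw => ⟨n, le_rfl, ?_⟩, fun {n x y} hw => ⟨n, le_rfl, ?_⟩⟩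
  · exact hw.map_of_isLink fun e x y => (hfg e x y).1
  · have := hw.map_of_isLink (f := f.symm) (g := g.symm) fun e x y hl => by
      rw [hfg]; simpa using hl
    simpa using this

end Isomorphic

/-! ### Deletion of an edge -/

section Delete

variable {α β : Type*} {G : Graph α β} {e : β}

theorem HasWalk.of_deleteEdges {F : Set β} {n : ℕ} {x y : α}
    (h : (G.deleteEdges F).HasWalk n x y) : G.HasWalk n x y := by
  induction h with
  | nil hx => exact .nil hx
  | cons h w ih => exact .cons h.1 ih

/-- A walk either avoids the edge `e` or decomposes at its first and last passage through `e`. -/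
theorem HasWalk.deleteEdges_or {a b : α} (he : G.IsLink e a b) {n : ℕ} {x y : α}
    (h : G.HasWalk n x y) : (G.deleteEdges {e}).HasWalk n x y ∨
      ∃ i j u v, i + j ≤ n ∧ (u = a ∨ u = b) ∧ (v = a ∨ v = b) ∧
        (G.deleteEdges {e}).HasWalk i x u ∧ (G.deleteEdges {e}).HasWalk j v y := by
  induction h with
  | nil hx => exact .inl (.nil hx)
  | @cons n f x y z hf w ih =>
    by_cases hfe : f = e
    · subst hfe
      have hx : x = a ∨ x = b := by
        rcases hf.eq_and_eq_or_eq_and_eq he with h | h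
        · exact .inl h.1
        · exact .inr h.1
      have hy : y = a ∨ y = b := by
        rcases hf.eq_and_eq_or_eq_and_eq he with h | h
        · exact .inr h.2
        · exact .inl h.2
      -- The first passage is at `x` itself, so the initial piece is trivial; of the remaining walk
      -- only the part after its last passage is kept.
      right
      rcases ih with ih | ⟨i, j, u, v, hij, hu, hv, h1, h2⟩
      · exact ⟨0, n, x, y, by omega, hx, hy, .nil hf.left_mem, ih⟩
      · exact ⟨0, j, x, v, by omega, hx, hv, .nil hf.left_mem, h2⟩
    · have hf' : (G.deleteEdges {e}).IsLink f x y := by simp [hf, hfe]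
      rcases ih with ih | ⟨i, j, u, v, hij, hu, hv, h1, h2⟩
      · exact .inl (.cons hf' ih)
      · exact .inr ⟨i + 1, j, u, v, by omega, hu, hv, .cons hf' h1, h2⟩

/-- The constant is the length `K` of a walk avoiding `e` between the ends of `e`; it is inserted at
most once, however often the given walk uses `e`. Pulling walks back costs nothing. -/
theorem exists_isRoughSurjection_deleteEdges (he : e ∈ E(G))
    (hH : (G.deleteEdges {e}).IsConnected) :
    ∃ f C, IsRoughSurjection G (G.deleteEdges {e}) f C := by
  obtain ⟨a, b, hab⟩ := G.exists_isLink_of_mem_edgeSet he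
  obtain ⟨K, hK⟩ := hH.2 a hab.left_mem b hab.right_mem
  have hjoin : ∀ u v, (u = a ∨ u = b) → (v = a ∨ v = b) →
      ∃ k ≤ K, (G.deleteEdges {e}).HasWalk k u v := by
    rintro u v (rfl | rfl) (rfl | rfl)
    · exact ⟨0, K.zero_le, .nil hab.left_mem⟩
    · exact ⟨K, le_rfl, hK⟩
    · exact ⟨K, le_rfl, hK.reverse⟩
    · exact ⟨0, K.zero_le, .nil hab.right_mem⟩
  refine ⟨fun x => ⟨x, x.2⟩, K, fun x => ⟨⟨x, x.2⟩, rfl⟩, fun {n x y} hw => ?_,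
    fun {n x y} hw => ⟨n, by omega, hw.of_deleteEdges⟩⟩
  rcases hw.deleteEdges_or hab with h | ⟨i, j, u, v, hij, hu, hv, h1, h2⟩
  · exact ⟨n, by omega, h⟩
  · obtain ⟨k, hk, hkw⟩ := hjoin u v hu hv
    exact ⟨i + k + j, by omega, (h1.append hkw).append h2⟩

end Delete

/-! ### Contraction of an edge -/

section Contract

variable {α β : Type*} {G : Graph α β} {e : β} {a b : α}

open Classical in
/-- The map on vertices that merges `b` into `a`. -/
noncomputable def mergeVertex (a b v : α) : α := if v = b then a else v

theorem eq_or_of_mergeVertex_eq {u v : α} (h : mergeVertex a b u = mergeVertex a b v) :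
    u = v ∨ ((u = a ∨ u = b) ∧ (v = a ∨ v = b)) := by
  unfold mergeVertex at h
  split_ifs at h <;> simp_all

theorem mergeVertex_eq_left {u : α} (h : u = a ∨ u = b) : mergeVertex a b u = a := by
  unfold mergeVertex
  split_ifs <;> simp_all

theorem contractEdge_isLink {f : β} {p q : α} : (G.contractEdge e a b).IsLink f p q ↔
    (∃ u v, G.IsLink f u v ∧ mergeVertex a b u = p ∧ mergeVertex a b v = q) ∧ f ≠ e := by
  simp [contractEdge, mergeVertex, Relation.Map]

theorem mem_vertexSet_contractEdge {p : α} :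
    p ∈ V(G.contractEdge e a b) ↔ ∃ u ∈ V(G), mergeVertex a b u = p := by
  simp [contractEdge, mergeVertex]

theorem HasWalk.exists_contractEdge (he : G.IsLink e a b) {n : ℕ} {x y : α}
    (h : G.HasWalk n x y) :
    ∃ m ≤ n, (G.contractEdge e a b).HasWalk m (mergeVertex a b x) (mergeVertex a b y) := by
  induction h with
  | nil hx => exact ⟨0, le_rfl, .nil (mem_vertexSet_contractEdge.2 ⟨_, hx, rfl⟩)⟩
  | @cons n f x y z hf w ih =>
    obtain ⟨m, hm, hw⟩ := ih
    by_cases hfe : f = e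
    · subst hfe
      refine ⟨m, by omega, ?_⟩
      have hxy : mergeVertex a b x = mergeVertex a b y := by
        rcases hf.eq_and_eq_or_eq_and_eq he with ⟨rfl, rfl⟩ | ⟨rfl, rfl⟩ <;>
          rw [mergeVertex_eq_left (by simp), mergeVertex_eq_left (by simp)]
      rwa [hxy]
    · exact ⟨m + 1, by omega, .cons (contractEdge_isLink.2 ⟨⟨x, y, hf, rfl, rfl⟩, hfe⟩) hw⟩

/-- A walk in the contracted graph lifts to a walk, or to two walks that end and start at an end
of the contracted edge. -/
theorem HasWalk.lift_contractEdge {n : ℕ} {p q : α} (h : (G.contractEdge e a b).HasWalk n p q)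
    {x y : α} (hx : x ∈ V(G)) (hy : y ∈ V(G)) (hxp : mergeVertex a b x = p)
    (hyq : mergeVertex a b y = q) : G.HasWalk n x y ∨
      ∃ i j u v, i + j ≤ n ∧ (u = a ∨ u = b) ∧ (v = a ∨ v = b) ∧
        G.HasWalk i x u ∧ G.HasWalk j v y := by
  -- The start must vary over its fibre: the lift of the next edge dictates where the remaining walk
  -- begins.
  induction h generalizing x with
  | nil hp =>
    rcases eq_or_of_mergeVertex_eq (hxp.trans hyq.symm) with rfl | ⟨h1, h2⟩
    · exact .inl (.nil hx)
    · exact .inr ⟨0, 0, x, y, by omega, h1, h2, .nil hx, .nil hy⟩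
  | @cons n f p p' q hf w ih =>
    obtain ⟨⟨u, v, huv, rfl, rfl⟩, -⟩ := contractEdge_isLink.1 hf
    have ih := ih huv.right_mem rfl hyq
    -- Either the lifted edge really starts at `x` and prolongs the lift, or `x` and its start are
    -- both ends of `e`. In the second case the lift breaks at `x`, and only the final piece is
    -- retained.
    rcases eq_or_of_mergeVertex_eq hxp with rfl | ⟨h1, h2⟩
    · rcases ih with ih | ⟨i, j, s, t, hij, hs, ht, w1, w2⟩
      · exact .inl (.cons huv ih)
      · exact .inr ⟨i + 1, j, s, t, by omega, hs, ht, .cons huv w1, w2⟩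
    · rcases ih with ih | ⟨i, j, s, t, hij, hs, ht, w1, w2⟩
      · exact .inr ⟨0, n + 1, x, u, by omega, h1, h2, .nil hx, .cons huv ih⟩
      · exact .inr ⟨0, j, x, t, by omega, h1, ht, .nil hx, w2⟩

/-- Pushing a walk forward just drops its passages through `e`; lifting one costs at most a single
passage through `e`, used to join the two pieces. -/
theorem exists_isRoughSurjection_contractEdge (he : G.IsLink e a b) :
    ∃ f, IsRoughSurjection G (G.contractEdge e a b) f 1 := by
  refine ⟨fun x => ⟨mergeVertex a b x, mem_vertexSet_contractEdge.2 ⟨x, x.2, rfl⟩⟩,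
    fun ⟨p, hp⟩ => ?_, fun {n x y} hw => ?_, fun {n x y} hw => ?_⟩
  · obtain ⟨u, hu, rfl⟩ := mem_vertexSet_contractEdge.1 hp
    exact ⟨⟨u, hu⟩, rfl⟩
  · obtain ⟨m, hm, hw⟩ := hw.exists_contractEdge he
    exact ⟨m, by omega, hw⟩
  · rcases hw.lift_contractEdge x.2 y.2 rfl rfl with h | ⟨i, j, u, v, hij, hu, hv, h1, h2⟩
    · exact ⟨n, by omega, h⟩
    · have hjoin : ∃ k ≤ 1, G.HasWalk k u v := by
        rcases hu with rfl | rfl <;> rcases hv with rfl | rfl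
        · exact ⟨0, zero_le_one, .nil he.left_mem⟩
        · exact ⟨1, le_rfl, .cons he (.nil he.right_mem)⟩
        · exact ⟨1, le_rfl, .cons he.symm (.nil he.left_mem)⟩
        · exact ⟨0, zero_le_one, .nil he.right_mem⟩
      obtain ⟨k, hk, hkw⟩ := hjoin
      exact ⟨i + k + j, by omega, (h1.append hkw).append h2⟩

end Contract

/-! ### Minors -/

section Minor

variable {α β α' β' : Type*} {G H : Graph α β}

theorem MinorStep.exists_isRoughSurjection (h : MinorStep G H) (hH : H.IsConnected) :
    ∃ f C, IsRoughSurjection G H f C := by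
  cases h with
  | delete he => exact exists_isRoughSurjection_deleteEdges he hH
  | contract h =>
    obtain ⟨f, hf⟩ := exists_isRoughSurjection_contractEdge h
    exact ⟨f, 1, hf⟩

theorem IsFiniteEdgeMinor.fourPoint_iff {G' : Graph α' β'} (h : IsFiniteEdgeMinor G G')
    (hG' : G'.IsConnected) : FourPoint G.rvdist ↔ FourPoint G'.rvdist := by
  obtain ⟨H, hGH, hiso⟩ := h
  obtain ⟨f, hf⟩ := hiso.exists_isRoughSurjection
  -- Connectedness is carried along, because a deletion is controlled only once the graph after it
  -- is known to be connected.
  suffices G.IsConnected ∧ (FourPoint G.rvdist ↔ FourPoint H.rvdist) from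
    this.2.trans (hf.fourPoint_iff hG')
  induction hGH using Relation.ReflTransGen.head_induction_on with
  | refl => exact ⟨hf.isConnected hG', Iff.rfl⟩
  | head hstep _ ih =>
    obtain ⟨f, C, hf⟩ := hstep.exists_isRoughSurjection ih.1
    exact ⟨hf.isConnected ih.1, (hf.fourPoint_iff ih.1).trans ih.2⟩

end Minor

/-! ### Vertices in the metric graph -/

namespace Point

variable {α β : Type*} {G : Graph α β}

theorem edist_vertex (x y : V(G)) : edist (vertex x) (vertex y) = G.vdist x y := by
  change pathDist _ _ = _
  simp [pathDist, along, cost, endpt]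

theorem cost_le_one (p : Point G) (i : Bool) : p.cost i ≤ 1 := by
  rcases p with x | ⟨e, t⟩
  · simp [cost]
  · cases i <;> simp only [cost] <;> rw [ENNReal.ofReal_le_one] <;> linarith [t.2.1, t.2.2]

theorem edist_vertex_endpt_le (p : Point G) :
    edist p (vertex ⟨p.endpt false, p.endpt_mem false⟩) ≤ 1 := by
  refine (pathDist_le p _ false false).trans ?_
  change p.cost false + G.vdist (p.endpt false) (p.endpt false) + 0 ≤ 1
  rw [vdist_self (p.endpt_mem false), add_zero, add_zero]
  exact p.cost_le_one false

theorem edist_ne_top (hG : G.IsConnected) (p q : Point G) : edist p q ≠ ⊤ := by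
  obtain ⟨n, -, hn⟩ := hG.exists_vdist_eq ⟨p.endpt false, p.endpt_mem false⟩
    ⟨q.endpt false, q.endpt_mem false⟩
  refine ne_top_of_le_ne_top ?_ (pathDist_le p q false false)
  rw [hn]
  have h1 := ne_top_of_le_ne_top ENNReal.one_ne_top (p.cost_le_one false)
  have h2 := ne_top_of_le_ne_top ENNReal.one_ne_top (q.cost_le_one false)
  finiteness

theorem rdist_vertex (x y : V(G)) : rdist (vertex x) (vertex y) = G.rvdist x y := by
  rw [rdist, edist_vertex, rvdist]

/-- Sending each point to a chosen end of its edge moves it by at most 1, hence changes distances by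
at most 2. -/
theorem fourPoint_iff (hG : G.IsConnected) :
    FourPoint (rdist : Point G → Point G → ℝ) ↔ FourPoint G.rvdist := by
  refine fourPoint_iff_of_surjective (fun p => ⟨p.endpt false, p.endpt_mem false⟩)
    (fun x => ⟨vertex x, rfl⟩) (C := 2) fun p q => ?_
  have hfin := edist_ne_top hG
  rw [← rdist_vertex]
  have near : ∀ p : Point G, rdist p (vertex ⟨p.endpt false, p.endpt_mem false⟩) ≤ 1 := fun p =>
    rdist_le_of_edist_le zero_le_one (by simpa using p.edist_vertex_endpt_le)
  have hp := near p
  have hq := near q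
  generalize (vertex ⟨p.endpt false, _⟩ : Point G) = p' at *
  generalize (vertex ⟨q.endpt false, _⟩ : Point G) = q' at *
  have t1 := rdist_triangle hfin p p' q
  have t2 := rdist_triangle hfin p' q' q
  have t3 := rdist_triangle hfin p' p q'
  have t4 := rdist_triangle hfin p q q'
  rw [rdist_comm q' q] at t2
  rw [rdist_comm p' p] at t3
  rw [abs_le]
  constructor <;> linarith

/-! ### Geodesics between vertices -/

open Classical in
/-- The edge `e`, parametrized by arc length from its source to its target. -/
noncomputable def edgePath (e : E(G)) (t : ℝ) : Point G :=
  if h : t ∈ Set.Ioo (0 : ℝ) 1 then inner e ⟨t, h⟩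
  else if t ≤ 0 then vertex ⟨G.src e, (G.isLink_src_tgt e).left_mem⟩
  else vertex ⟨G.tgt e, (G.isLink_src_tgt e).right_mem⟩

theorem edgePath_zero (e : E(G)) :
    edgePath e 0 = vertex ⟨G.src e, (G.isLink_src_tgt e).left_mem⟩ := by
  simp [edgePath]

theorem edgePath_one (e : E(G)) :
    edgePath e 1 = vertex ⟨G.tgt e, (G.isLink_src_tgt e).right_mem⟩ := by
  simp [edgePath]

/-- Equality fails in general, for instance between the two ends of a loop; the lower bound will
come from minimality of a whole walk. -/
theorem edist_edgePath_le_of_le (e : E(G)) {s t : ℝ} (hs : 0 ≤ s) (hst : s ≤ t) (ht : t ≤ 1) :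
    edist (edgePath e s) (edgePath e t) ≤ ENNReal.ofReal (t - s) := by
  rcases hst.eq_or_lt with rfl | hlt
  · simp
  rcases hs.eq_or_lt with rfl | hs
  · rcases ht.eq_or_lt with rfl | ht
    · rw [edgePath_zero, edgePath_one, edist_vertex]
      have hl := G.isLink_src_tgt e
      simpa using (HasWalk.cons hl (.nil hl.right_mem)).vdist_le
    · rw [edgePath_zero, edgePath, dif_pos ⟨hlt, ht⟩]
      refine (pathDist_le _ _ false false).trans ?_
      simp [cost, endpt, vdist_self (G.isLink_src_tgt e).left_mem]
  · rcases ht.eq_or_lt with rfl | ht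
    · rw [edgePath_one, edgePath, dif_pos ⟨hs, hlt⟩]
      refine (pathDist_le _ _ true true).trans ?_
      simp [cost, endpt, vdist_self (G.isLink_src_tgt e).right_mem]
    · rw [edgePath, dif_pos ⟨hs, hlt.trans ht⟩, edgePath, dif_pos ⟨hs.trans hlt, ht⟩]
      refine (min_le_left _ _).trans ?_
      simp [along, abs_sub_comm s t, abs_of_pos (sub_pos.2 hlt)]

theorem exists_path_of_isLink {e : β} {x y : α} (h : G.IsLink e x y) :
    ∃ γ : ℝ → Point G, γ 0 = vertex ⟨x, h.left_mem⟩ ∧ γ 1 = vertex ⟨y, h.right_mem⟩ ∧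
      ∀ s t, 0 ≤ s → s ≤ t → t ≤ 1 → edist (γ s) (γ t) ≤ ENNReal.ofReal (t - s) := by
  have he : e ∈ E(G) := h.edge_mem
  rcases h.eq_and_eq_or_eq_and_eq (G.isLink_src_tgt ⟨e, he⟩) with ⟨rfl, rfl⟩ | ⟨rfl, rfl⟩
  · exact ⟨edgePath ⟨e, he⟩, edgePath_zero _, edgePath_one _,
      fun s t => edist_edgePath_le_of_le _⟩
  -- The link runs against the arbitrarily chosen direction of the edge.
  · refine ⟨fun t => edgePath ⟨e, he⟩ (1 - t), ?_, ?_, fun s t h0 hst h1 => ?_⟩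
    · simpa using edgePath_one _
    · simpa using edgePath_zero _
    · rw [edist_comm]
      refine (edist_edgePath_le_of_le _ (by linarith) (by linarith) (by linarith)).trans_eq ?_
      congr 1
      ring

theorem exists_path_of_hasWalk {n : ℕ} {x y : α} (h : G.HasWalk n x y) :
    ∃ γ : ℝ → Point G, γ 0 = vertex ⟨x, h.left_mem⟩ ∧ γ n = vertex ⟨y, h.right_mem⟩ ∧
      ∀ s t : ℝ, 0 ≤ s → s ≤ t → t ≤ n → edist (γ s) (γ t) ≤ ENNReal.ofReal (t - s) := by
  induction h with
  | @nil x hx =>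
    exact ⟨fun _ => vertex ⟨x, hx⟩, rfl, rfl, fun s t _ _ _ => by simp⟩
  | @cons n e x y z h w ih =>
    obtain ⟨σ, σ0, σ1, hσ⟩ := exists_path_of_isLink h
    obtain ⟨τ, τ0, τ1, hτ⟩ := ih
    refine ⟨fun t => if t ≤ 1 then σ t else τ (t - 1), by simp [σ0], ?_,
      fun s t hs hst ht => ?_⟩
    -- For `n = 0` the final time is 1, which still belongs to the branch `σ`.
    · rcases n.eq_zero_or_pos with rfl | hn
      · have : y = z := by cases w; rfl
        subst this
        simpa using σ1
      ·   simp [hn.ne', τ1]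
    · push_cast at ht
      dsimp only
      by_cases h1 : t ≤ 1
      · rw [if_pos h1, if_pos (hst.trans h1)]
        exact hσ s t hs hst h1
      · rw [if_neg h1]
        rw [not_le] at h1
        by_cases h2 : s ≤ 1
        · rw [if_pos h2]
          calc _ ≤ edist (σ s) (σ 1) + edist (τ 0) (τ (t - 1)) := by
                rw [σ1, τ0]; exact edist_triangle _ _ _
            _ ≤ ENNReal.ofReal (1 - s) + ENNReal.ofReal (t - 1 - 0) :=
                add_le_add (hσ _ _ hs h2 le_rfl)
                  (hτ _ _ le_rfl (by linarith) (by linarith))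
            _ = _ := by
                rw [← ENNReal.ofReal_add (by linarith) (by linarith)]
                congr 1
                ring
        · rw [if_neg h2]
          rw [not_le] at h2
          refine (hτ _ _ (by linarith) (by linarith) (by linarith)).trans_eq ?_
          congr 1
          ring

/-- A 1-Lipschitz path whose duration equals the distance between its ends is a geodesic, since a
shortcut between two of its points would shorten the whole. -/
theorem exists_isGeodesicBetween_vertex (hG : G.IsConnected) (x y : V(G)) :
    ∃ S, IsGeodesicBetween (vertex x) (vertex y) S := by
  obtain ⟨n, hn, hd⟩ := hG.exists_vdist_eq x y
  obtain ⟨γ, γ0, γ1, hγ⟩ := exists_path_of_hasWalk hn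
  have key : ∀ s t : ℝ, 0 ≤ s → s ≤ t → t ≤ n → edist (γ s) (γ t) = ENNReal.ofReal (t - s) := by
    intro s t hs hst ht
    refine le_antisymm (hγ s t hs hst ht) ?_
    have htot : ENNReal.ofReal n ≤
        ENNReal.ofReal s + edist (γ s) (γ t) + ENNReal.ofReal (n - t) := by
      calc ENNReal.ofReal n = edist (γ 0) (γ n) := by
            rw [γ0, γ1, edist_vertex, hd, ENNReal.ofReal_natCast]
        _ ≤ edist (γ 0) (γ s) + edist (γ s) (γ t) + edist (γ t) (γ n) := edist_triangle4 _ _ _ _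
        _ ≤ _ := by
            gcongr
            · simpa using hγ 0 s le_rfl hs (hst.trans ht)
            · exact hγ t n (hs.trans hst) ht le_rfl
    have hfin := edist_ne_top hG (γ s) (γ t)
    rw [← ENNReal.ofReal_toReal hfin] at htot ⊢
    rw [← ENNReal.ofReal_add hs ENNReal.toReal_nonneg,
      ← ENNReal.ofReal_add (add_nonneg hs ENNReal.toReal_nonneg) (sub_nonneg.2 ht),
      ENNReal.ofReal_le_ofReal_iff
        (add_nonneg (add_nonneg hs ENNReal.toReal_nonneg) (sub_nonneg.2 ht))] at htot
    exact ENNReal.ofReal_le_ofReal (by linarith)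
  refine ⟨_, n, γ, n.cast_nonneg, γ0, γ1, fun s hs t ht => ?_, rfl⟩
  rcases le_total s t with h | h
  · rw [key s t hs.1 h ht.2, abs_sub_comm, abs_of_nonneg (sub_nonneg.2 h)]
  · rw [edist_comm, key t s ht.1 h hs.2, abs_of_nonneg (sub_nonneg.2 h)]

end Point

/-- Forwards, geodesics have to be constructed only between vertices. Backwards, the four-point
condition is extended to all points, and the geodesics are those of the given triangle. -/
theorem IsConnected.isHyperbolic_iff_fourPoint {α β : Type*} {G : Graph α β}
    (hG : G.IsConnected) : IsHyperbolic G.Point ↔ FourPoint G.rvdist := by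
  have hfin := Point.edist_ne_top hG
  refine ⟨fun h => ?_, fun h => isHyperbolic_of_fourPoint hfin ((Point.fourPoint_iff hG).2 h)⟩
  have := h.fourPoint hfin Point.vertex (Point.exists_isGeodesicBetween_vertex hG)
  simpa only [Point.rdist_vertex] using this

end Graph

theorem theorem4p7 {α β α' β' : Type*} (G : Graph α β) (G' : Graph α' β')
    (hG : G.IsConnected) (hG' : G'.IsConnected) (hminor : G.IsFiniteEdgeMinor G') :
    IsHyperbolic G.Point ↔ IsHyperbolic G'.Point := by
  rw [hG.isHyperbolic_iff_fourPoint, hG'.isHyperbolic_iff_fourPoint, hminor.fourPoint_iff hG']
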